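/- **Lemma 4.2.** Let $R$ be either the standard graded polynomial ring $K[x_0,\dots,x_n]$ over a field $K$, with $\mathfrak m=(x_0,\dots,x_n)$, or a regular local ring containing a field, with maximal ideal $\mathfrak m$. Let $M$ and $N$ be finitely generated $R$-modules, graded if $R$ is the polynomial ring. Here $\dim$ is the Krull dimension, with the convention that the zero module has dimension $0$. We say that $M$ and $N$ *intersect properly* if $$\dim (M\otimes_R N)=\dim M+\dim N-\dim R,$$ and that they *intersect very properly* if $\dim M+\dim N\ge\dim R$ and, for all integers $i,j$, $$\dim\bigl(\operatorname{Ext}^i_R(M,R)\otimes_R\operatorname{Ext}^j_R(N,R)\bigr)=\max\{0,\ \dim\operatorname{Ext}^i_R(M,R)+\dim\operatorname{Ext}^j_R(N,R)-\dim R\}.$$ A module is *unmixed* if all its associated primes have the same height, and $M$ is *locally Cohen–Macaulay* if $M_{\mathfrak p}$ is a Cohen–Macaulay $R_{\mathfrak p}$-module (that is, zero or of depth equal to its dimension) for every prime ideal $\mathfrak p\ne\mathfrak m$ of $R$. Then: (a) If $M$ and $N$ intersect very properly, then they intersect properly. (b) If $M$ and $N$ are unmixed and locally Cohen–Macaulay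 and intersect properly, then they intersect very properly. -/

import Mathlib

open scoped TensorProduct

universe u

/-- The Krull dimension of a module, i.e. the Krull dimension of its support, as a natural number.
The zero module gets dimension `0`. (Over a ring of finite Krull dimension no other convention is
involved, since then the dimension of a nonzero module is a natural number.) -/
noncomputable def moduleDim (R : Type*) [CommRing R] (M : Type*) [AddCommGroup M] [Module R M] :
    ℕ :=
  ((Module.supportDim R M).unbotD 0).toNat

/-- The `R`-module `Ext_R^i(M, R)`. -/
abbrev ExtRing (R : Type u) [CommRing R] (M : Type u) [AddCommGroup M] [Module R M] (i : ℕ) :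
    Type u :=
  CategoryTheory.Abelian.Ext (ModuleCat.of R M) (ModuleCat.of R R) i

/-- `M` and `N` intersect properly: `dim (M ⊗ N) = dim M + dim N - dim R`. -/
def IntersectProperly (R : Type*) [CommRing R] (M N : Type*) [AddCommGroup M] [Module R M]
    [AddCommGroup N] [Module R N] : Prop :=
  (moduleDim R (M ⊗[R] N) : ℤ) = moduleDim R M + moduleDim R N - moduleDim R R

/-- `M` and `N` intersect very properly: `dim M + dim N ≥ dim R`, and
`dim (Ext^i(M,R) ⊗ Ext^j(N,R)) = max {0, dim Ext^i(M,R) + dim Ext^j(N,R) - dim R}` for all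
`i` and `j`. (For negative `i` or `j` the modules are zero and the equation reads `0 = 0`.) -/
def IntersectVeryProperly (R : Type u) [CommRing R] (M N : Type u) [AddCommGroup M] [Module R M]
    [AddCommGroup N] [Module R N] : Prop :=
  moduleDim R R ≤ moduleDim R M + moduleDim R N ∧
    ∀ i j : ℕ, (moduleDim R (ExtRing R M i ⊗[R] ExtRing R N j) : ℤ) =
      max 0 ((moduleDim R (ExtRing R M i) : ℤ) + moduleDim R (ExtRing R N j) - moduleDim R R)

/-- A module is unmixed if all its associated primes have the same height. -/
def IsUnmixedModule (R : Type*) [CommRing R] (M : Type*) [AddCommGroup M] [Module R M] : Prop :=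
  ∀ p ∈ associatedPrimes R M, ∀ q ∈ associatedPrimes R M, p.height = q.height

/-- The depth of a module over a local ring: the supremum of the lengths of the `M`-regular
sequences in the maximal ideal. -/
noncomputable def localDepth (R : Type*) [CommRing R] [IsLocalRing R] (M : Type*) [AddCommGroup M]
    [Module R M] : ℕ∞ :=
  ⨆ rs : {rs : List R //
      (∀ r ∈ rs, r ∈ IsLocalRing.maximalIdeal R) ∧ RingTheory.Sequence.IsRegular M rs},
    (rs.1.length : ℕ∞)

/-- A module over a local ring is Cohen-Macaulay if it is zero or its depth is its dimension. -/
def IsCohenMacaulayModule (R : Type*) [CommRing R] [IsLocalRing R] (M : Type*) [AddCommGroup M]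
    [Module R M] : Prop :=
  Subsingleton M ∨ (localDepth R M : WithBot ℕ∞) = Module.supportDim R M

/-- `M` is locally Cohen-Macaulay (with respect to the distinguished maximal ideal `m`): the
localization of `M` at every prime ideal other than `m` is Cohen-Macaulay. -/
def IsLocallyCohenMacaulay (R : Type*) [CommRing R] (m : Ideal R) (M : Type*) [AddCommGroup M]
    [Module R M] : Prop :=
  ∀ (p : Ideal R) [p.IsPrime], p ≠ m →
    IsCohenMacaulayModule (Localization.AtPrime p) (LocalizedModule p.primeCompl M)

/-- The irrelevant maximal ideal `(x_0, …, x_n)` of `K[x_0, …, x_n]`. -/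
noncomputable def irrelevantMaximalIdeal (K : Type*) [Field K] (n : ℕ) :
    Ideal (MvPolynomial (Fin (n + 1)) K) :=
  Ideal.span (Set.range MvPolynomial.X)

/-- `M` admits the structure of a (`ℤ`-)graded module over `K[x_0, …, x_n]` with its standard
grading. -/
def IsGradedModule (K : Type*) [Field K] (n : ℕ) (M : Type*) [AddCommGroup M]
    [Module (MvPolynomial (Fin (n + 1)) K) M] : Prop :=
  ∃ A : ℤ → AddSubgroup M, DirectSum.IsInternal A ∧
    ∀ (d : ℕ) (j : ℤ), ∀ f ∈ MvPolynomial.homogeneousSubmodule (Fin (n + 1)) K d, ∀ x ∈ A j,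
      f • x ∈ A (d + j)

/-! The supports of the modules Ext^i(M, R) cover Supp M, and dimension depends only on support. If
every maximal ideal of a Noetherian ring R is generated by a regular sequence, then Ext^i(R/p, R)_p
is nonzero exactly for i = ht p (`MaximalIdealsGeneratedByRegularSequences.hasExtIndices`):
induction along the sequence gives this at maximal ideals, and Nakayama carries it down each cover q
⋖ p, lowering the degree by one. An associated prime q of M then lies in Supp Ext^{ht q}(M, R), so
Supp M is the union of the Supp Ext^i(M, R) (`ExtRing.iUnion_support`). Both kinds of ring in the
theorem have such maximal ideals.

For (a), Supp(M ⊗ N) = Supp M ∩ Supp N is the union of the supports of the Ext^i(M, R) ⊗ Ext^j(N,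
R). All three dimensions are therefore maxima over i and j, and the equation for proper intersection
is the maximum of the given ones.

For (b), if all associated primes of M have height c and M_p is Cohen–Macaulay, then Ext^i(M, R)_p =
0 for i ≠ c (`ExtRing.notMem_support_of_isCohenMacaulay`). Away from 𝔪 only Ext^c survives, with the
same support as M, and the closed point 𝔪 does not affect dimension. All other Ext modules have
dimension 0. -/

open CategoryTheory CategoryTheory.Abelian

/-! ### Ext(-, R) as a contravariant functor with its long exact sequence -/

namespace ExtRing

variable {R : Type u} [CommRing R]

section Functoriality

variable {A B C : Type u} [AddCommGroup A] [Module R A] [AddCommGroup B] [Module R B]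
  [AddCommGroup C] [Module R C]

/-- The map on `Ext(-, R)` induced by a linear map. -/
noncomputable def map (f : A →ₗ[R] B) (i : ℕ) : ExtRing R B i →ₗ[R] ExtRing R A i :=
  (Ext.mk₀ (ModuleCat.ofHom f)).precompOfLinear R (ModuleCat.of R R) (zero_add i)

lemma map_comp (f : A →ₗ[R] B) (g : B →ₗ[R] C) (i : ℕ) (x : ExtRing R C i) :
    map f i (map g i x) = map (g ∘ₗ f) i x := by
  simp only [map, Ext.precompOfLinear, Ext.bilinearCompOfLinear_apply_apply]
  rw [ModuleCat.ofHom_comp, ← Ext.mk₀_comp_mk₀,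
    Ext.comp_assoc (a₁₂ := 0) (a₂₃ := i) (a := i) _ _ _ _ _ (by simp)]

lemma map_smul_id (r : R) (i : ℕ) (x : ExtRing R A i) :
    map (r • (LinearMap.id : A →ₗ[R] A)) i x = r • x := by
  have : ModuleCat.ofHom (r • (LinearMap.id : A →ₗ[R] A)) = r • 𝟙 (ModuleCat.of R A) := rfl
  simp only [map, Ext.precompOfLinear, Ext.bilinearCompOfLinear_apply_apply]
  rw [this, Ext.mk₀_smul, Ext.smul_comp, Ext.mk₀_id_comp]

@[simp]
lemma map_zero (i : ℕ) (x : ExtRing R B i) : map (0 : A →ₗ[R] B) i x = 0 := by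
  have : ModuleCat.ofHom (0 : A →ₗ[R] B) = 0 := rfl
  simp only [map, Ext.precompOfLinear, Ext.bilinearCompOfLinear_apply_apply]
  rw [this, Ext.mk₀_zero, Ext.zero_comp]

lemma map_id (i : ℕ) (x : ExtRing R A i) : map (LinearMap.id : A →ₗ[R] A) i x = x := by
  simpa using map_smul_id (1 : R) i x

/-- `Ext(-, R)` of a linear equivalence. -/
noncomputable def congr (e : A ≃ₗ[R] B) (i : ℕ) : ExtRing R B i ≃ₗ[R] ExtRing R A i :=
  LinearEquiv.ofLinearMap (map e.toLinearMap i) (map e.symm.toLinearMap i)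
    (by ext x; simp [map_comp, map_id]) (by ext x; simp [map_comp, map_id])

variable {f : A →ₗ[R] B} {g : B →ₗ[R] C} (hf : Function.Injective f)
  (hg : Function.Surjective g) (hfg : Function.Exact f g)

include hf hg hfg in
lemma exists_long_exact : ∃ δ : ∀ i, ExtRing R A i →ₗ[R] ExtRing R C (i + 1),
    (∀ i, Function.Exact (map g i) (map f i)) ∧ (∀ i, Function.Exact (map f i) (δ i)) ∧
      ∀ i, Function.Exact (δ i) (map g (i + 1)) := by
  let S : ShortComplex (ModuleCat.{u} R) :=
    ShortComplex.mk (ModuleCat.ofHom f) (ModuleCat.ofHom g)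
      (by rw [← ModuleCat.ofHom_comp, hfg.linearMap_comp_eq_zero]; rfl)
  have hS : S.ShortExact :=
    { exact := (ShortComplex.ShortExact.moduleCat_exact_iff_function_exact _).mpr hfg
      mono_f := (ModuleCat.mono_iff_injective _).mpr hf
      epi_g := (ModuleCat.epi_iff_surjective _).mpr hg }
  have hzero : ∀ i (x : ExtRing R C i), map f i (map g i x) = 0 := fun i x ↦ by
    rw [map_comp, hfg.linearMap_comp_eq_zero]
    exact map_zero i x
  refine ⟨fun i ↦ hS.extClass.precompOfLinear R (ModuleCat.of R R) (add_comm 1 i),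
    fun i y ↦ ⟨fun h ↦ ?_, ?_⟩, fun i y ↦ ⟨fun h ↦ ?_, ?_⟩, fun i y ↦ ⟨fun h ↦ ?_, ?_⟩⟩
  · exact Ext.contravariant_sequence_exact₂ hS (ModuleCat.of R R) y h
  · rintro ⟨x, rfl⟩
    exact hzero i x
  · exact Ext.contravariant_sequence_exact₁ hS (ModuleCat.of R R) y (add_comm 1 i) h
  · rintro ⟨x, rfl⟩
    exact hS.extClass_comp_assoc x (h := add_comm 1 i)
  · exact Ext.contravariant_sequence_exact₃ hS (ModuleCat.of R R) y h (add_comm 1 i)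
  · rintro ⟨x, rfl⟩
    exact hS.comp_extClass_assoc x (add_comm 1 i)

end Functoriality

end ExtRing

open Module

/-! ### Supports of Ext modules -/

section Support

variable {R : Type u} [CommRing R] {p : PrimeSpectrum R}

lemma Module.notMem_support_of_exact {A B C : Type*} [AddCommGroup A] [Module R A]
    [AddCommGroup B] [Module R B] [AddCommGroup C] [Module R C] {f : A →ₗ[R] B} {g : B →ₗ[R] C}
    (h : Function.Exact f g) (hA : p ∉ support R A) (hC : p ∉ support R C) :
    p ∉ support R B := by
  rw [notMem_support_iff'] at *
  intro b
  obtain ⟨s, hs, hsb⟩ := hC (g b)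
  rw [← map_smul] at hsb
  obtain ⟨a, ha⟩ := (h _).mp hsb
  obtain ⟨t, ht, hta⟩ := hA a
  exact ⟨t * s, p.2.mul_notMem ht hs, by rw [mul_smul, ← ha, ← map_smul, hta, map_zero]⟩

lemma Module.notMem_support_of_subsingleton (M : Type*) [AddCommGroup M] [Module R M]
    [Subsingleton M] : p ∉ support R M := by
  simp [support_eq_empty]

namespace ExtRing

variable {A B C : Type u} [AddCommGroup A] [Module R A] [AddCommGroup B] [Module R B]
  [AddCommGroup C] [Module R C] {f : A →ₗ[R] B} {g : B →ₗ[R] C} (hf : Function.Injective f)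
  (hg : Function.Surjective g) (hfg : Function.Exact f g)

include hf hg hfg

lemma notMem_support_middle {i : ℕ} (hA : p ∉ support R (ExtRing R A i))
    (hC : p ∉ support R (ExtRing R C i)) : p ∉ support R (ExtRing R B i) := by
  obtain ⟨δ, h₁, -, -⟩ := exists_long_exact hf hg hfg
  exact notMem_support_of_exact (h₁ i) hC hA

lemma notMem_support_left {i : ℕ} (hB : p ∉ support R (ExtRing R B i))
    (hC : p ∉ support R (ExtRing R C (i + 1))) : p ∉ support R (ExtRing R A i) := by
  obtain ⟨δ, -, h₂, -⟩ := exists_long_exact hf hg hfg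
  exact notMem_support_of_exact (h₂ i) hB hC

omit hf hg hfg

lemma support_congr (e : A ≃ₗ[R] B) (i : ℕ) :
    support R (ExtRing R A i) = support R (ExtRing R B i) :=
  (congr e i).symm.support_eq

lemma smul_eq_zero_of_smul_eq_zero {r : R} (hr : ∀ a : A, r • a = 0) {i : ℕ}
    (x : ExtRing R A i) : r • x = 0 := by
  have : r • (LinearMap.id : A →ₗ[R] A) = 0 := by ext a; simpa using hr a
  rw [← map_smul_id, this, map_zero]

/-- The annihilator of `A` kills Ext, by functoriality in the first argument. -/
lemma support_subset [Module.Finite R A] (i : ℕ) :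
    support R (ExtRing R A i) ⊆ support R A := by
  intro q hq
  rw [mem_support_iff_of_finite]
  intro r hr
  by_contra h
  exact notMem_support_iff'.mpr
    (fun x ↦ ⟨r, h, smul_eq_zero_of_smul_eq_zero (mem_annihilator.mp hr) x⟩) hq

lemma subsingleton_of_free [Module.Free R A] (i : ℕ) : Subsingleton (ExtRing R A (i + 1)) := by
  have : Projective (ModuleCat.of R A) := ModuleCat.projective_of_free (Module.Free.chooseBasis R A)
  exact ⟨fun x y ↦ (Ext.eq_zero_of_projective x).trans (Ext.eq_zero_of_projective y).symm⟩

/-- `Ext^0(A, R)` is the dual of `A`. -/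
noncomputable def zeroEquiv (A : Type u) [AddCommGroup A] [Module R A] :
    ExtRing R A 0 ≃ₗ[R] (A →ₗ[R] R) :=
  Ext.linearEquiv₀.trans ModuleCat.homLinearEquiv

instance finite [IsNoetherianRing R] (A : Type u) [AddCommGroup A] [Module R A]
    [Module.Finite R A] (i : ℕ) : Module.Finite R (ExtRing R A i) := by
  induction i generalizing A with
  | zero => exact Module.Finite.equiv (zeroEquiv A).symm
  | succ i ih =>
    -- Dimension shifting: `δ` from the Ext of the syzygy module is onto because the free module has
    -- no higher Ext.
    obtain ⟨n, g, hg⟩ := Module.Finite.exists_fin' R A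
    obtain ⟨δ, -, -, h₃⟩ := exists_long_exact (LinearMap.ker g).injective_subtype hg
      (LinearMap.exact_subtype_ker_map g)
    have := subsingleton_of_free (R := R) (A := Fin n → R) i
    have := ih (LinearMap.ker g)
    exact Module.Finite.of_surjective (δ i) fun x ↦ (h₃ i x).mp (Subsingleton.elim _ _)

end ExtRing

end Support

/-! ### Ext and multiplication by ring elements -/

open scoped Pointwise

namespace ExtRing

variable {R : Type u} [CommRing R] {p : PrimeSpectrum R}
variable {M : Type u} [AddCommGroup M] [Module R M]

/-- Nakayama's lemma for `Ext(-, R)` localized at `p`, along multiplication by an element of `p`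
that is injective near `p`. -/
lemma notMem_support_of_quotSMulTop [IsNoetherianRing R] [Module.Finite R M] {x : R}
    (hx : x ∈ p.asIdeal) (hker : p ∉ support R (LinearMap.ker (LinearMap.lsmul R M x))) {i : ℕ}
    (h : p ∉ support R (ExtRing R (QuotSMulTop x M) (i + 1))) :
    p ∉ support R (ExtRing R M i) := by
  -- Multiplication by `x` factors as M ↠ xM ↪ M, giving two long exact sequences. The kernel of the
  -- first map vanishes at `p`, so `x` need only be injective there.
  let I : Submodule R M := x • ⊤
  let π : M →ₗ[R] I := (LinearMap.lsmul R M x).codRestrict I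
    fun m ↦ Submodule.smul_mem_pointwise_smul m x ⊤ trivial
  have hπ : Function.Surjective π := by
    rintro ⟨_, m, -, rfl⟩
    exact ⟨m, rfl⟩
  have hker' : LinearMap.ker π = LinearMap.ker (LinearMap.lsmul R M x) :=
    LinearMap.ker_codRestrict _ _ _
  obtain ⟨-, h₁, -, -⟩ := exists_long_exact (LinearMap.ker π).injective_subtype hπ
    (LinearMap.exact_subtype_ker_map π)
  obtain ⟨δ, -, h₂, -⟩ := exists_long_exact I.injective_subtype I.mkQ_surjective
    (LinearMap.exact_subtype_mkQ I)
  have hK : p ∉ support R (ExtRing R (LinearMap.ker π) i) := by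
    refine fun hmem ↦ hker ?_
    rw [← hker']
    exact support_subset i hmem
  rw [notMem_support_iff'] at h hK
  have hcomp : I.subtype ∘ₗ π = x • LinearMap.id := rfl
  intro hp
  -- Nakayama in terms of supports: it suffices that E/xE vanishes at `p`, where E = Ext^i(M, R). Up
  -- to multipliers outside `p`, each class in E lifts through both restriction maps, hence is a
  -- multiple of `x`.
  have : p ∈ support R (QuotSMulTop x (ExtRing R M i)) := by
    rw [support_quotSMulTop]
    exact ⟨hp, by simpa using hx⟩
  refine notMem_support_iff'.mpr (fun m ↦ ?_) this
  obtain ⟨n, rfl⟩ := Submodule.mkQ_surjective _ m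
  obtain ⟨s, hs, hsn⟩ := hK (map (LinearMap.ker π).subtype i n)
  rw [← map_smul] at hsn
  obtain ⟨a, ha⟩ := (h₁ i _).mp hsn
  obtain ⟨t, ht, hta⟩ := h (δ i a)
  rw [← map_smul] at hta
  obtain ⟨b, hb⟩ := (h₂ i _).mp hta
  refine ⟨t * s, p.2.mul_notMem ht hs, ?_⟩
  rw [← map_smul, mul_smul, ← ha, ← map_smul, ← hb, map_comp, hcomp, map_smul_id]
  exact (Submodule.Quotient.mk_eq_zero _).mpr (Submodule.smul_mem_pointwise_smul b x ⊤ trivial)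

lemma notMem_support_of_isSMulRegular [IsNoetherianRing R] [Module.Finite R M] {x : R}
    (hx : x ∈ p.asIdeal) (hreg : IsSMulRegular M x) {i : ℕ}
    (h : p ∉ support R (ExtRing R (QuotSMulTop x M) (i + 1))) :
    p ∉ support R (ExtRing R M i) := by
  refine notMem_support_of_quotSMulTop hx ?_ h
  have : LinearMap.ker (LinearMap.lsmul R M x) = ⊥ := LinearMap.ker_eq_bot.mpr hreg
  rw [this]
  exact notMem_support_of_subsingleton _

lemma subsingleton_quotSMulTop {x : R} (hreg : IsSMulRegular M x) {i : ℕ}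
    (h₁ : Subsingleton (ExtRing R M i)) (h₂ : Subsingleton (ExtRing R M (i + 1))) :
    Subsingleton (ExtRing R (QuotSMulTop x M) (i + 1)) := by
  obtain ⟨δ, -, -, h₃⟩ := exists_long_exact (f := LinearMap.lsmul R M x)
    (g := (x • (⊤ : Submodule R M)).mkQ) hreg (Submodule.mkQ_surjective _) (fun m ↦ by
      rw [Submodule.mkQ_apply, Submodule.Quotient.mk_eq_zero]
      exact ⟨fun ⟨a, _, ha⟩ ↦ ⟨a, ha⟩, fun ⟨a, ha⟩ ↦ ⟨a, trivial, ha⟩⟩)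
  refine ⟨fun a b ↦ ?_⟩
  obtain ⟨a', rfl⟩ := (h₃ i a).mp (Subsingleton.elim _ _)
  obtain ⟨b', rfl⟩ := (h₃ i b).mp (Subsingleton.elim _ _)
  rw [Subsingleton.elim a' b']

/-- Each regular element raises the last possibly nonzero degree by at most one. -/
lemma subsingleton_quotient_ofList (rs : List R) (n : ℕ) :
    ∀ (M : Type u) [AddCommGroup M] [Module R M], RingTheory.Sequence.IsWeaklyRegular M rs →
    (∀ i, n < i → Subsingleton (ExtRing R M i)) → ∀ i, n + rs.length < i →
      Subsingleton (ExtRing R (M ⧸ (Ideal.ofList rs • ⊤ : Submodule R M)) i) := by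
  induction rs generalizing n with
  | nil =>
    intro M _ _ _ h i hi
    have e : (M ⧸ (Ideal.ofList ([] : List R) • ⊤ : Submodule R M)) ≃ₗ[R] M :=
      Submodule.quotEquivOfEqBot _ 
        (by rw [Ideal.ofList_nil]; exact Submodule.bot_smul (R := R) ⊤)
    have := h i (by simpa using hi)
    exact (congr e i).symm.toEquiv.subsingleton
  | cons x rs ih =>
    intro M _ _ hreg h i hi
    rw [RingTheory.Sequence.isWeaklyRegular_cons_iff] at hreg
    have e := Submodule.quotOfListConsSMulTopEquivQuotSMulTopInner M x rs
    have := ih (n + 1) (QuotSMulTop x M) hreg.2 (fun j hj ↦ by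
      obtain ⟨j, rfl⟩ : ∃ k, j = k + 1 := ⟨j - 1, by omega⟩
      exact subsingleton_quotSMulTop hreg.1 (h j (by omega)) (h _ (by omega))) i
      (by simp at hi; omega)
    exact (congr e i).symm.toEquiv.subsingleton

end ExtRing

/-- An element `x` that kills `K` acts as zero on Ext(K, N), so by the long exact sequence each
class of Ext^{i+1}(K, N) comes from Ext^i(K, N/xN). -/
lemma CategoryTheory.Abelian.Ext.subsingleton_of_isWeaklyRegular {R : Type u} [CommRing R]
    (K : Type u) [AddCommGroup K] [Module R K] (rs : List R)
    (hrs : ∀ r ∈ rs, ∀ k : K, r • k = 0) :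
    ∀ (N : Type u) [AddCommGroup N] [Module R N], RingTheory.Sequence.IsWeaklyRegular N rs →
      ∀ i < rs.length, Subsingleton (Ext (ModuleCat.of R K) (ModuleCat.of R N) i) := by
  induction rs with
  | nil => intro N _ _ _ i hi; simp at hi
  | cons x rs ih =>
    intro N _ _ hreg i hi
    rw [RingTheory.Sequence.isWeaklyRegular_cons_iff] at hreg
    have hx : ∀ y : Ext (ModuleCat.of R K) (ModuleCat.of R N) i, x • y = 0 := fun y ↦ by
      have h0 : x • 𝟙 (ModuleCat.of R K) = 0 := by
        ext k
        exact hrs x (by simp) k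
      rw [← Ext.mk₀_id_comp y, ← Ext.smul_comp, ← Ext.mk₀_smul, h0]
      simp
    let S : ShortComplex (ModuleCat.{u} R) :=
      ShortComplex.mk (ModuleCat.ofHom (LinearMap.lsmul R N x))
        (ModuleCat.ofHom (x • (⊤ : Submodule R N)).mkQ)
        (by
          ext n
          exact (Submodule.Quotient.mk_eq_zero _).mpr
            (Submodule.smul_mem_pointwise_smul n x ⊤ trivial))
    have hS : S.ShortExact :=
      { exact := (ShortComplex.ShortExact.moduleCat_exact_iff_function_exact _).mpr (fun m ↦ by
          change Submodule.mkQ _ m = 0 ↔ _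
          rw [Submodule.mkQ_apply, Submodule.Quotient.mk_eq_zero]
          exact ⟨fun ⟨a, _, ha⟩ ↦ ⟨a, ha⟩, fun ⟨a, ha⟩ ↦ ⟨a, trivial, ha⟩⟩)
        mono_f := (ModuleCat.mono_iff_injective _).mpr hreg.1
        epi_g := (ModuleCat.epi_iff_surjective _).mpr (Submodule.mkQ_surjective _) }
    suffices ∀ y : Ext (ModuleCat.of R K) (ModuleCat.of R N) i, y = 0 from
      ⟨fun a b ↦ (this a).trans (this b).symm⟩
    intro y
    have hy : y.comp (Ext.mk₀ S.f) (add_zero i) = 0 := by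
      have : S.f = x • 𝟙 (ModuleCat.of R N) := rfl
      rw [this, ← Ext.smul_eq_comp_mk₀, hx]
    cases i with
    | zero =>
      have := hS.mono_f
      exact Ext.postcomp_mk₀_injective_of_mono (ModuleCat.of R K) S.f (by simpa using hy)
    | succ i =>
      obtain ⟨z, rfl⟩ := Ext.covariant_sequence_exact₁ (ModuleCat.of R K) hS y hy rfl
      have := ih (fun r hr ↦ hrs r (by simp [hr])) (QuotSMulTop x N) hreg.2 i (by simpa using hi)
      rw [Subsingleton.elim z 0, Ext.zero_comp]

/-! ### Heights and covers in a Noetherian spectrum -/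

namespace PrimeSpectrum

variable {R : Type*} [CommRing R] [IsNoetherianRing R]

/-- The height of a point of the spectrum of a Noetherian ring, as a natural number. -/
noncomputable def natHeight (p : PrimeSpectrum R) : ℕ := p.asIdeal.height.toNat

lemma coe_natHeight (p : PrimeSpectrum R) : (p.natHeight : ℕ∞) = p.asIdeal.height :=
  ENat.natCast_toNat Ideal.height_ne_top_of_isPrime

lemma natHeight_strictMono : StrictMono (natHeight (R := R)) := by
  intro q p h
  have : q.asIdeal.height + 1 ≤ p.asIdeal.height := Ideal.height_add_one_le_of_lt_of_isPrime h
  rw [← coe_natHeight, ← coe_natHeight] at this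
  exact_mod_cast this

lemma natHeight_le_iff {p : PrimeSpectrum R} {n : ℕ} :
    p.natHeight ≤ n ↔ ∀ q < p, q.natHeight < n := by
  rw [← Nat.cast_le (α := ℕ∞), coe_natHeight, Ideal.height_le_iff]
  refine ⟨fun h q hq ↦ ?_, fun h q hq hlt ↦ ?_⟩
  · have := h q.asIdeal q.2 hq
    rw [← coe_natHeight] at this
    exact_mod_cast this
  · rw [← coe_natHeight ⟨q, hq⟩]
    exact_mod_cast h ⟨q, hq⟩ hlt

instance : WellFoundedLT (PrimeSpectrum R) := natHeight_strictMono.wellFoundedLT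

instance : WellFoundedGT (PrimeSpectrum R) :=
  StrictMono.wellFoundedGT (β := Ideal R) (f := asIdeal) fun _ _ h ↦ h

instance : IsStronglyAtomic (PrimeSpectrum R) := .of_wellFounded_lt wellFounded_lt

instance : IsStronglyCoatomic (PrimeSpectrum R) := .of_wellFounded_gt wellFounded_gt

end PrimeSpectrum

open PrimeSpectrum

/-! ### Reduction to quotients by primes -/

namespace ExtRing

variable {R : Type u} [CommRing R] [IsNoetherianRing R] {p q : PrimeSpectrum R}
variable {M : Type u} [AddCommGroup M] [Module R M]

omit [IsNoetherianRing R] in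
lemma mem_support_quotient_iff {I : Ideal R} : p ∈ support R (R ⧸ I) ↔ I ≤ p.asIdeal := by
  rw [mem_support_iff_of_finite, Ideal.annihilator_quotient]

/-- Dévissage along a prime filtration; only primes inside `p` matter at `p`. -/
lemma notMem_support_of_forall_quotient [Module.Finite R M] {i : ℕ}
    (h : ∀ q ∈ support R M, q ≤ p → p ∉ support R (ExtRing R (R ⧸ q.asIdeal) i)) :
    p ∉ support R (ExtRing R M i) := by
  revert h
  induction ‹Module.Finite R M› using
    IsNoetherianRing.induction_on_isQuotientEquivQuotientPrime R with
  | subsingleton N => exact fun _ hp ↦ notMem_support_of_subsingleton N (support_subset i hp)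
  | quotient N q e =>
    intro h hp
    have hle : q ≤ p := mem_support_quotient_iff.mp (e.support_eq ▸ support_subset i hp)
    exact h q (e.support_eq ▸ mem_support_quotient_iff.mpr le_rfl) hle (support_congr e i ▸ hp)
  | exact N₁ N₂ N₃ f g hf hg hfg h₁ h₃ =>
    intro h
    have hsupp := support_of_exact hfg hf hg
    exact notMem_support_middle hf hg hfg (h₁ fun q hq ↦ h q (hsupp ▸ Or.inl hq))
      (h₃ fun q hq ↦ h q (hsupp ▸ Or.inr hq))

/-- An element of `p` outside `q` is regular on R/q, and the quotient by it is supported on primes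
strictly above `q`. Nakayama then trades `q` for larger primes and degree `i` for `i + 1`. -/
lemma notMem_support_quotient_of_lt {i : ℕ} (hlt : q < p)
    (h : ∀ q', q < q' → q' ≤ p → p ∉ support R (ExtRing R (R ⧸ q'.asIdeal) (i + 1))) :
    p ∉ support R (ExtRing R (R ⧸ q.asIdeal) i) := by
  obtain ⟨x, hxp, hxq⟩ := SetLike.exists_of_lt (show q.asIdeal < p.asIdeal from hlt)
  have hreg : IsSMulRegular (R ⧸ q.asIdeal) x := by
    intro a b hab
    simp only [Algebra.smul_def] at hab
    exact mul_left_cancel₀ (by simpa [Ideal.Quotient.eq_zero_iff_mem] using hxq) hab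
  refine notMem_support_of_isSMulRegular hxp hreg (notMem_support_of_forall_quotient ?_)
  intro q' hq' hle
  rw [support_quotSMulTop] at hq'
  refine h q' (lt_of_le_of_ne (mem_support_quotient_iff.mp hq'.1) ?_) hle
  rintro rfl
  exact hxq (by simpa using hq'.2)

/-- The previous step iterated up to `p`, with `φ` recording which pairs of prime and degree are
claimed to vanish. -/
lemma notMem_support_quotient_of_forall {φ : PrimeSpectrum R → ℕ → Prop}
    (hp : ∀ i, φ p i → p ∉ support R (ExtRing R (R ⧸ p.asIdeal) i))
    (hφ : ∀ q q' i, φ q i → q < q' → q' ≤ p → φ q' (i + 1)) {i : ℕ} (hle : q ≤ p) (hq : φ q i) :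
    p ∉ support R (ExtRing R (R ⧸ q.asIdeal) i) := by
  induction q using WellFoundedGT.induction generalizing i with
  | ind q ih =>
    obtain rfl | hlt := hle.eq_or_lt
    · exact hp i hq
    · exact notMem_support_quotient_of_lt hlt fun q' hlt' hle' ↦
        ih q' hlt' hle' (hφ q q' i hq hlt' hle')

lemma notMem_support_quotient_of_covBy {i : ℕ} (h : q ⋖ p)
    (hp : p ∉ support R (ExtRing R (R ⧸ p.asIdeal) (i + 1))) :
    q ∉ support R (ExtRing R (R ⧸ q.asIdeal) i) := by
  refine fun hq ↦ notMem_support_quotient_of_lt h.lt (fun q' hlt hle ↦ ?_)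
    (mem_support_mono h.le hq)
  obtain rfl : q' = p := hle.eq_of_not_lt (h.2 hlt)
  exact hp

omit [IsNoetherianRing R] in
lemma mem_support_self_zero (p : PrimeSpectrum R) : p ∈ support R (ExtRing R R 0) := by
  rw [(zeroEquiv R).support_eq, (LinearMap.ringLmapEquivSelf R R R).support_eq,
    mem_support_iff_of_finite, (annihilator_eq_bot (R := R) (M := R)).mpr inferInstance]
  exact bot_le

/-- Vanishing in all degrees would climb down to every prime below `p`, and dévissage would give
Hom(R, R)_p = 0. -/
lemma exists_mem_support_quotient (p : PrimeSpectrum R) :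
    ∃ i, p ∈ support R (ExtRing R (R ⧸ p.asIdeal) i) := by
  by_contra! h
  exact notMem_support_of_forall_quotient (M := R) (i := 0) (fun q _ hle ↦
    notMem_support_quotient_of_forall (φ := fun _ _ ↦ True) (fun i _ ↦ h i)
      (fun _ _ _ _ _ _ ↦ trivial) hle trivial) (mem_support_self_zero p)

end ExtRing

/-! ### The Gorenstein property -/

/-- The modules `Ext^i(R ⧸ p, R)_p` vanish for all `i` but `h`. -/
def HasExtIndex {R : Type u} [CommRing R] (p : PrimeSpectrum R) (h : ℕ) : Prop :=
  ∀ i, p ∈ support R (ExtRing R (R ⧸ p.asIdeal) i) ↔ i = h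

namespace HasExtIndex

open ExtRing

variable {R : Type u} [CommRing R] [IsNoetherianRing R] {p q : PrimeSpectrum R} {h : ℕ}

lemma of_forall_ne (H : ∀ i, i ≠ h → p ∉ support R (ExtRing R (R ⧸ p.asIdeal) i)) :
    HasExtIndex p h := by
  have hi : ∀ i, p ∈ support R (ExtRing R (R ⧸ p.asIdeal) i) → i = h := fun i hi ↦ by
    by_contra hne
    exact H i hne hi
  refine fun i ↦ ⟨hi i, ?_⟩
  rintro rfl
  obtain ⟨j, hj⟩ := exists_mem_support_quotient p
  rwa [← hi j hj]

/-- Below the length, Ext vanishes because the sequence is regular on the second argument R; above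
it, because R/p is obtained from R by that many regular quotients. -/
lemma of_isWeaklyRegular {rs : List R} (hrs : RingTheory.Sequence.IsWeaklyRegular R rs)
    (hp : Ideal.ofList rs = p.asIdeal) : HasExtIndex p rs.length := by
  refine of_forall_ne fun i hi ↦ ?_
  suffices Subsingleton (ExtRing R (R ⧸ p.asIdeal) i) from notMem_support_of_subsingleton _
  obtain hlt | hgt := hi.lt_or_gt
  · refine Ext.subsingleton_of_isWeaklyRegular (R ⧸ p.asIdeal) rs (fun r hr k ↦ ?_) R hrs i hlt
    obtain ⟨k, rfl⟩ := Ideal.Quotient.mk_surjective k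
    rw [Algebra.smul_def, Ideal.Quotient.algebraMap_eq, ← map_mul,
      Ideal.Quotient.eq_zero_iff_mem, ← hp]
    exact Ideal.mul_mem_right _ _ (Ideal.subset_span hr)
  · have := subsingleton_quotient_ofList rs 0 R hrs (fun j hj ↦ by
      obtain ⟨j, rfl⟩ : ∃ k, j = k + 1 := ⟨j - 1, by omega⟩
      exact subsingleton_of_free j) i (by omega)
    have e : (R ⧸ (Ideal.ofList rs • ⊤ : Submodule R R)) ≃ₗ[R] R ⧸ p.asIdeal :=
      Submodule.quotEquivOfEq _ _ (by simp [hp])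
    exact (ExtRing.congr e i).toEquiv.subsingleton

lemma exists_of_covBy (H : HasExtIndex p h) (hqp : q ⋖ p) :
    ∃ h', h = h' + 1 ∧ HasExtIndex q h' := by
  have key : ∀ i, q ∈ support R (ExtRing R (R ⧸ q.asIdeal) i) → i + 1 = h := fun i hi ↦ by
    by_contra hne
    exact notMem_support_quotient_of_covBy hqp (fun hp ↦ hne ((H _).mp hp)) hi
  obtain ⟨i, hi⟩ := exists_mem_support_quotient q
  refine ⟨i, (key i hi).symm, of_forall_ne fun j hj hmem ↦ hj ?_⟩
  have := key i hi
  have := key j hmem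
  omega

/-- Along a cover the index drops by exactly one, so all primes covered by `p` have the same height,
and `p` has height one more. -/
lemma eq_natHeight (H : HasExtIndex p h) : h = p.natHeight := by
  induction p using WellFoundedLT.induction generalizing h with
  | ind p ih =>
    by_cases hmin : ∃ q, q < p
    · obtain ⟨q₀, hq₀⟩ := hmin
      obtain ⟨q, -, hq⟩ := exists_le_covBy_of_lt hq₀
      obtain ⟨h', rfl, H'⟩ := H.exists_of_covBy hq
      have := ih q hq.lt H'
      refine le_antisymm ?_ (natHeight_le_iff.mpr fun q₁ hq₁ ↦ ?_)
      · have := natHeight_strictMono hq.lt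
        omega
      · obtain ⟨q₂, hle, hq₂⟩ := exists_le_covBy_of_lt hq₁
        obtain ⟨h'', hh, H''⟩ := H.exists_of_covBy hq₂
        have := ih q₂ hq₂.lt H''
        have := natHeight_strictMono.monotone hle
        omega
    · push Not at hmin
      have h0 : p.natHeight = 0 := Nat.le_zero.mp
        (natHeight_le_iff.mpr fun q hq ↦ absurd hq (hmin q))
      rw [h0]
      by_contra hne
      -- For a minimal prime, dévissage of R at `p` involves only R/p, so Hom(R, R)_p ≠ 0 forces
      -- index 0.
      refine notMem_support_of_forall_quotient (M := R) (i := 0) (fun q _ hle ↦ ?_)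
        (mem_support_self_zero p)
      obtain rfl : q = p := hle.eq_of_not_lt (hmin q)
      exact fun hmem ↦ hne ((H 0).mp hmem).symm

end HasExtIndex

/-- Every maximal ideal of `R` is generated by a regular sequence. -/
def MaximalIdealsGeneratedByRegularSequences (R : Type*) [CommRing R] : Prop :=
  ∀ m : Ideal R, m.IsMaximal → ∃ rs : List R,
    RingTheory.Sequence.IsWeaklyRegular R rs ∧ Ideal.ofList rs = m

/-- The Gorenstein property of `R`, in the form of a condition on the Bass numbers of `R`. -/
class HasExtIndices (R : Type u) [CommRing R] : Prop where
  hasExtIndex_natHeight : ∀ p : PrimeSpectrum R, HasExtIndex p (p.asIdeal.height.toNat)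

lemma MaximalIdealsGeneratedByRegularSequences.hasExtIndices {R : Type u} [CommRing R]
    [IsNoetherianRing R] (H : MaximalIdealsGeneratedByRegularSequences R) : HasExtIndices R := by
  have key : ∀ p : PrimeSpectrum R, ∃ h, HasExtIndex p h := by
    intro p
    induction p using WellFoundedGT.induction with
    | ind p ih =>
      by_cases hp : p.asIdeal.IsMaximal
      · obtain ⟨rs, hrs, hrsp⟩ := H _ hp
        exact ⟨_, .of_isWeaklyRegular hrs hrsp⟩
      · obtain ⟨m, hm, hpm⟩ := p.asIdeal.exists_le_maximal p.2.ne_top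
        have hlt : p < ⟨m, hm.isPrime⟩ := lt_of_le_of_ne hpm fun h ↦ hp (h ▸ hm)
        obtain ⟨p', hpp', -⟩ := exists_covBy_le_of_lt hlt
        obtain ⟨h, H'⟩ := ih p' hpp'.lt
        obtain ⟨h', -, H''⟩ := H'.exists_of_covBy hpp'
        exact ⟨h', H''⟩
  refine ⟨fun p ↦ ?_⟩
  obtain ⟨h, hh⟩ := key p
  have := hh.eq_natHeight
  rwa [this] at hh

/-! ### Vanishing and nonvanishing of Ext in terms of heights -/

namespace ExtRing

section

variable {R : Type u} [CommRing R] [IsNoetherianRing R] [HasExtIndices R] {p q : PrimeSpectrum R}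
variable {M : Type u} [AddCommGroup M] [Module R M] [Module.Finite R M]

lemma notMem_support_of_natHeight_lt {i : ℕ} (hi : p.natHeight < i) :
    p ∉ support R (ExtRing R M i) :=
  notMem_support_of_forall_quotient fun _ _ hle ↦
    notMem_support_quotient_of_forall (φ := fun _ j ↦ p.natHeight < j)
      (fun j hj hmem ↦ hj.ne' ((HasExtIndices.hasExtIndex_natHeight p j).mp hmem))
      (fun _ _ _ hj _ _ ↦ hj.trans (Nat.lt_succ_self _)) hle hi

lemma notMem_support_of_forall_lt_natHeight {i : ℕ}
    (hi : ∀ q ∈ support R M, q ≤ p → i < q.natHeight) : p ∉ support R (ExtRing R M i) :=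
  notMem_support_of_forall_quotient fun q hq hle ↦
    notMem_support_quotient_of_forall (φ := fun q j ↦ j < q.natHeight)
      (fun j hj hmem ↦ hj.ne ((HasExtIndices.hasExtIndex_natHeight p j).mp hmem))
      (fun _ _ _ hj hlt _ ↦ (Nat.succ_le_of_lt hj).trans_lt (natHeight_strictMono hlt)) hle
      (hi q hq hle)

/-- At `q`, Ext vanishes above degree ht q, so the inclusion R/q ↪ M induces a surjection in that
degree onto a nonzero module. -/
lemma mem_support_natHeight_of_isAssociatedPrime (hq : IsAssociatedPrime q.asIdeal M) :
    q ∈ support R (ExtRing R M q.natHeight) := by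
  obtain ⟨-, f, hf⟩ := (isAssociatedPrime_iff_exists_injective_linearMap _ _).mp hq
  by_contra h
  exact notMem_support_left hf (Submodule.mkQ_surjective _) (LinearMap.exact_map_mkQ_range f) h
    (notMem_support_of_natHeight_lt (Nat.lt_succ_self _))
    ((HasExtIndices.hasExtIndex_natHeight q _).mpr rfl)

omit [HasExtIndices R] in
lemma exists_isAssociatedPrime_le (hp : p ∈ support R M) :
    ∃ q : PrimeSpectrum R, IsAssociatedPrime q.asIdeal M ∧ q ≤ p := by
  obtain ⟨q, hq, hqp⟩ := Ideal.exists_minimalPrimes_le (mem_support_iff_of_finite.mp hp)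
  exact ⟨⟨q, hq.isPrime⟩,
    Module.associatedPrimes.minimalPrimes_annihilator_subset_associatedPrimes R M hq, hqp⟩

lemma exists_mem_support (hp : p ∈ support R M) : ∃ i, p ∈ support R (ExtRing R M i) := by
  obtain ⟨q, hq, hqp⟩ := exists_isAssociatedPrime_le hp
  exact ⟨_, mem_support_mono hqp (mem_support_natHeight_of_isAssociatedPrime hq)⟩

end

end ExtRing

/-! ### Cohen–Macaulay localizations -/

lemma Submodule.localized'_pointwise_smul_top {R : Type*} [CommRing R] (T : Submonoid R)
    (S : Type*) [CommRing S] [Algebra R S] [IsLocalization T S]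
    {M N : Type*} [AddCommGroup M] [Module R M] [AddCommGroup N] [Module R N] [Module S N]
    [IsScalarTower R S N] (f : M →ₗ[R] N) [IsLocalizedModule T f] (r : R) (s : T) :
    (r • (⊤ : Submodule R M)).localized' S T f =
      IsLocalization.mk' S r s • (⊤ : Submodule S N) := by
  ext n
  rw [Submodule.mem_localized', Submodule.mem_smul_pointwise_iff_exists]
  constructor
  · rintro ⟨_, ⟨m, -, rfl⟩, t, rfl⟩
    refine ⟨s • IsLocalizedModule.mk' f m t, trivial, ?_⟩
    rw [Submonoid.smul_def, ← algebraMap_smul S (s : R), smul_smul, IsLocalization.mk'_spec,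
      algebraMap_smul, ← IsLocalizedModule.mk'_smul]
    rfl
  · rintro ⟨n, -, rfl⟩
    obtain ⟨⟨m, t⟩, rfl⟩ := IsLocalizedModule.mk'_surjective T f n
    exact ⟨r • m, Submodule.smul_mem_pointwise_smul m r ⊤ trivial, s * t,
      (IsLocalizedModule.mk'_smul_mk' S f r m s t).symm⟩

namespace ExtRing

variable {R : Type u} [CommRing R] [IsNoetherianRing R] [HasExtIndices R] {p q : PrimeSpectrum R}

/-- Each regular element lowers the vanishing bound ht p by one. The localization `N` is an
arbitrary model, so that the induction can pass to quotients. -/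
lemma notMem_support_of_isWeaklyRegular (S : Type*) [CommRing S] [Algebra R S] [IsLocalRing S]
    [IsLocalization.AtPrime S p.asIdeal] (rs : List S) :
    ∀ (M : Type u) [AddCommGroup M] [Module R M] [Module.Finite R M]
      (N : Type u) [AddCommGroup N] [Module R N] [Module S N] [IsScalarTower R S N]
      (f : M →ₗ[R] N) [IsLocalizedModule p.asIdeal.primeCompl f],
      RingTheory.Sequence.IsWeaklyRegular N rs →
      (∀ r ∈ rs, r ∈ IsLocalRing.maximalIdeal S) →
      ∀ i, p.natHeight < i + rs.length → p ∉ support R (ExtRing R M i) := by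
  induction rs with
  | nil =>
    intro M _ _ _ N _ _ _ _ f _ _ _ i hi
    exact notMem_support_of_natHeight_lt (by simpa using hi)
  | cons a rs ih =>
    intro M _ _ _ N _ _ _ _ f _ hreg hmem i hi
    rw [RingTheory.Sequence.isWeaklyRegular_cons_iff] at hreg
    obtain ⟨r, s, rfl⟩ := IsLocalization.exists_mk'_eq p.asIdeal.primeCompl a
    have hr : r ∈ p.asIdeal :=
      (IsLocalization.AtPrime.mk'_mem_maximal_iff S p.asIdeal r s).mp (hmem _ (by simp))
    refine notMem_support_of_quotSMulTop hr ?_ ?_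
    · rw [notMem_support_iff']
      rintro ⟨m, hm⟩
      have hm' : r • m = 0 := hm
      have hfm : f m = 0 := by
        apply hreg.1
        change IsLocalization.mk' S r s • f m = IsLocalization.mk' S r s • 0
        rw [smul_zero, ← IsLocalizedModule.mk'_one p.asIdeal.primeCompl f m,
          IsLocalizedModule.mk'_smul_mk', hm', IsLocalizedModule.mk'_zero]
      obtain ⟨t, ht⟩ := (IsLocalizedModule.eq_zero_iff p.asIdeal.primeCompl f).mp hfm
      exact ⟨t, t.2, Subtype.ext ht⟩
    · refine ih (QuotSMulTop r M) _
        ((r • (⊤ : Submodule R M)).toLocalizedQuotient' S p.asIdeal.primeCompl f) ?_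
        (fun r hr ↦ hmem r (by simp [hr])) (i + 1) (by simp at hi; omega)
      have e := Submodule.quotEquivOfEq _ _
        (Submodule.localized'_pointwise_smul_top p.asIdeal.primeCompl S f r s)
      exact (LinearEquiv.isWeaklyRegular_congr e rs).mpr hreg.2

/-- Heights drop by exactly one along covers, because Ext indices do. -/
lemma exists_ltSeries {n : ℕ} (hle : q ≤ p) (hn : p.natHeight = q.natHeight + n) :
    ∃ s : LTSeries (PrimeSpectrum R), s.head = q ∧ s.last = p ∧ s.length = n := by
  induction n generalizing p with
  | zero =>
    obtain rfl | hlt := hle.eq_or_lt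
    · exact ⟨RelSeries.singleton _ q, rfl, rfl, rfl⟩
    · exact absurd hn (natHeight_strictMono hlt).ne'
  | succ n ih =>
    have hlt : q < p := lt_of_le_of_ne hle (by rintro rfl; omega)
    obtain ⟨q', hle', hq'⟩ := exists_le_covBy_of_lt hlt
    obtain ⟨h, hh, H⟩ := (HasExtIndices.hasExtIndex_natHeight p).exists_of_covBy hq'
    have := H.eq_natHeight
    have hp : p.natHeight = h + 1 := hh
    obtain ⟨s, hs₁, hs₂, hs₃⟩ := ih hle' (by omega)
    exact ⟨s.snoc p (by rw [hs₂]; exact hq'.lt), by simpa using hs₁, by simp, by simpa using hs₃⟩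

lemma natHeight_sub_le_supportDim {M : Type u} [AddCommGroup M] [Module R M]
    (hq : q ∈ support R M) (hle : q ≤ p) :
    ((p.natHeight - q.natHeight : ℕ) : WithBot ℕ∞) ≤
      supportDim (Localization.AtPrime p.asIdeal) (LocalizedModule p.asIdeal.primeCompl M) := by
  obtain ⟨s, hs₁, hs₂, hs₃⟩ := exists_ltSeries hle
    (Nat.add_sub_of_le (natHeight_strictMono.monotone hle)).symm
  let e := IsLocalization.AtPrime.primeSpectrumOrderIso (Localization.AtPrime p.asIdeal) p.asIdeal
  have hlast : ∀ i, s i ≤ p := fun i ↦ hs₂ ▸ s.monotone (Fin.le_last i)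
  have hhead : ∀ i, q ≤ s i := fun i ↦ hs₁ ▸ s.monotone (Fin.zero_le i)
  have hmem : ∀ i, e.symm ⟨s i, hlast i⟩ ∈ support (Localization.AtPrime p.asIdeal)
      (LocalizedModule p.asIdeal.primeCompl M) := fun i ↦ by
    have hcomap : ((e.symm ⟨s i, hlast i⟩).asIdeal).comap (algebraMap R _) = (s i).asIdeal := by
      have := e.apply_symm_apply ⟨s i, hlast i⟩
      exact congrArg (fun x ↦ x.1.asIdeal) this
    obtain ⟨m, hm⟩ := mem_support_iff'.mp (mem_support_mono (hhead i) hq)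
    refine mem_support_iff'.mpr ⟨LocalizedModule.mk m 1, fun a ha h0 ↦ ?_⟩
    obtain ⟨r, t, rfl⟩ := IsLocalization.exists_mk'_eq p.asIdeal.primeCompl a
    rw [← Localization.mk_eq_mk', LocalizedModule.mk_smul_mk, ← LocalizedModule.zero_mk 1,
      LocalizedModule.mk_eq] at h0
    obtain ⟨u, hu⟩ := h0
    simp only [one_smul, smul_zero, Submonoid.smul_def, smul_smul] at hu
    refine hm _ ((s i).2.mul_notMem (fun hmem ↦ u.2 (hlast i hmem)) fun hmem ↦ ha ?_) hu
    rw [← hcomap, Ideal.mem_comap] at hmem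
    rw [IsLocalization.mk'_eq_mul_mk'_one]
    exact Ideal.mul_mem_right _ _ hmem
  let s' : LTSeries (support (Localization.AtPrime p.asIdeal)
      (LocalizedModule p.asIdeal.primeCompl M)) :=
    { length := s.length
      toFun i := ⟨e.symm ⟨s i, hlast i⟩, hmem i⟩
      step i := e.symm.lt_iff_lt.mpr (s.step i) }
  rw [← hs₃]
  exact Order.LTSeries.length_le_krullDim s'

/-- A Cohen-Macaulay localization of `M` sees at most one of the modules `Ext^i(M, R)`. -/
lemma notMem_support_of_isCohenMacaulay {M : Type u} [AddCommGroup M] [Module R M]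
    [Module.Finite R M] {c : ℕ}
    (hc : ∀ q : PrimeSpectrum R, IsAssociatedPrime q.asIdeal M → q.natHeight = c)
    (hCM : IsCohenMacaulayModule (Localization.AtPrime p.asIdeal)
      (LocalizedModule p.asIdeal.primeCompl M)) {i : ℕ} (hi : i ≠ c) :
    p ∉ support R (ExtRing R M i) := by
  intro hp
  have hpM := support_subset i hp
  have hnt : Nontrivial (LocalizedModule p.asIdeal.primeCompl M) := mem_support_iff.mp hpM
  replace hCM := hCM.resolve_left (not_subsingleton _)
  -- Below `c`, every prime of the support has height at least `c`. Above `c`, depth = dim ≥ ht p -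
  -- c provides a long enough regular sequence.
  obtain hlt | hgt := hi.lt_or_gt
  · refine notMem_support_of_forall_lt_natHeight (fun q hq _ ↦ ?_) hp
    obtain ⟨q', hq', hle⟩ := exists_isAssociatedPrime_le hq
    have := natHeight_strictMono.monotone hle
    have := hc q' hq'
    omega
  · obtain ⟨q, hq, hle⟩ := exists_isAssociatedPrime_le hpM
    have hqM : q ∈ support R M := support_subset _ (mem_support_natHeight_of_isAssociatedPrime hq)
    have hdim := natHeight_sub_le_supportDim hqM hle
    have := natHeight_strictMono.monotone hle
    rw [← hCM, hc q hq] at hdim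
    have hdepth : ((p.natHeight - c : ℕ) : ℕ∞) ≤ localDepth (Localization.AtPrime p.asIdeal)
      (LocalizedModule p.asIdeal.primeCompl M) := WithBot.coe_le_coe.mp hdim
    obtain ⟨rs, hmem, hreg, hlen⟩ : ∃ rs : List (Localization.AtPrime p.asIdeal),
        (∀ r ∈ rs, r ∈ IsLocalRing.maximalIdeal (Localization.AtPrime p.asIdeal)) ∧
        RingTheory.Sequence.IsWeaklyRegular (LocalizedModule p.asIdeal.primeCompl M) rs ∧
        p.natHeight - c ≤ rs.length := by
      obtain h0 | h0 := (p.natHeight - c).eq_zero_or_pos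
      · exact ⟨[], by simp, .nil _ _, by simp [h0]⟩
      -- Depth is a supremum, so a strict bound is needed to extract an actual sequence.
      · have hlt : ((p.natHeight - c - 1 : ℕ) : ℕ∞) < localDepth (Localization.AtPrime p.asIdeal)
            (LocalizedModule p.asIdeal.primeCompl M) :=
          lt_of_lt_of_le (by exact_mod_cast Nat.sub_one_lt_of_lt h0) hdepth
        obtain ⟨rs, hrs⟩ := lt_iSup_iff.mp hlt
        refine ⟨rs.1, rs.2.1, rs.2.2.toIsWeaklyRegular, ?_⟩
        have : p.natHeight - c - 1 < rs.1.length := by exact_mod_cast hrs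
        omega
    exact notMem_support_of_isWeaklyRegular (Localization.AtPrime p.asIdeal) rs M
      (LocalizedModule p.asIdeal.primeCompl M) (LocalizedModule.mkLinearMap _ M) hreg hmem i
      (by omega) hp

end ExtRing

/-! ### Regular local rings -/

section RegularLocal

open IsLocalRing

lemma IsLocalRing.spanFinrank_maximalIdeal_quotient_span_singleton_le {R : Type*} [CommRing R]
    [IsLocalRing R] [IsNoetherianRing R] {n : ℕ} (hn : (maximalIdeal R).spanFinrank = n + 1)
    {x : R} (hx : x ∈ maximalIdeal R) (hx2 : x ∉ maximalIdeal R ^ 2)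
    [IsLocalRing (R ⧸ Ideal.span {x})] :
    (maximalIdeal (R ⧸ Ideal.span {x})).spanFinrank ≤ n := by
  classical
  obtain ⟨s, hcard, hs⟩ :=
    Submodule.FG.exists_span_finset_card_eq_spanFinrank (maximalIdeal R).fg_of_isNoetherianRing
  obtain ⟨f, -, hf⟩ := Submodule.mem_span_finset.mp (hs ▸ hx)
  -- Since `x` is not in 𝔪², some coefficient is a unit, and that generator becomes redundant modulo
  -- `x`.
  obtain ⟨a, ha, hfa⟩ : ∃ a ∈ s, f a ∉ maximalIdeal R := by
    by_contra! h
    refine hx2 (hf ▸ Ideal.sum_mem _ fun a ha ↦ ?_)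
    rw [pow_two]
    exact Ideal.mul_mem_mul (h a ha) (hs ▸ Submodule.subset_span ha)
  have hfa' : IsUnit (f a) := by simpa using hfa
  have hmax : maximalIdeal (R ⧸ Ideal.span {x}) =
      Ideal.span ((s.erase a).image (Ideal.Quotient.mk (Ideal.span {x})) : Set _) := by
    have hle : Ideal.span {x} ≤ maximalIdeal R := (Ideal.span_singleton_le_iff_mem _).mpr hx
    have hmap : maximalIdeal (R ⧸ Ideal.span {x}) =
        (maximalIdeal R).map (Ideal.Quotient.mk (Ideal.span {x})) := by
      rw [IsLocalRing.map_maximalIdeal_of_surjective _ Ideal.Quotient.mk_surjective]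
    have hs' : maximalIdeal R = Ideal.span (s : Set R) := hs.symm
    rw [hmap, hs', Ideal.map_span]
    refine le_antisymm (Ideal.span_le.mpr ?_) (Ideal.span_mono ?_)
    · rintro _ ⟨b, hb, rfl⟩
      have hmem : ∀ c ∈ s.erase a, Ideal.Quotient.mk (Ideal.span {x}) c ∈
          Ideal.span ((s.erase a).image (Ideal.Quotient.mk (Ideal.span {x})) : Set _) :=
        fun c hc ↦ Ideal.subset_span (Finset.mem_coe.mpr (Finset.mem_image_of_mem _ hc))
      by_cases hba : b = a
      · subst hba
        rw [← Finset.add_sum_erase s _ hb] at hf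
        have hx0 : Ideal.Quotient.mk (Ideal.span {x}) x = 0 :=
          Ideal.Quotient.eq_zero_iff_mem.mpr (Ideal.mem_span_singleton_self x)
        rw [SetLike.mem_coe, ← Ideal.unit_mul_mem_iff_mem _
          (hfa'.map (Ideal.Quotient.mk (Ideal.span {x}))), ← map_mul]
        have hfb : f b * b = x - ∑ i ∈ s.erase b, f i • i := eq_sub_of_add_eq hf
        rw [hfb, map_sub, hx0, zero_sub, map_sum]
        refine neg_mem (Ideal.sum_mem _ fun c hc ↦ ?_)
        rw [smul_eq_mul, map_mul]
        exact Ideal.mul_mem_left _ _ (hmem c hc)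
      · exact hmem b (by simpa [hba] using hb)
    · rw [Finset.coe_image]
      exact Set.image_mono (Finset.erase_subset a s)
  rw [hmax]
  refine (Submodule.spanFinrank_span_le_ncard_of_finite (Finset.finite_toSet _)).trans ?_
  rw [Set.ncard_coe_finset]
  refine Finset.card_image_le.trans ?_
  rw [Finset.card_erase_of_mem ha, hcard, hn]
  rfl

/-- Prime avoidance for the minimal primes and 𝔪², which may be a non-prime member of the family. -/
lemma IsLocalRing.exists_mem_maximalIdeal_notMem_sq {R : Type*} [CommRing R] [IsLocalRing R]
    [IsNoetherianRing R] {n : ℕ} (hn : ringKrullDim R = (n + 1 : ℕ)) :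
    ∃ x ∈ maximalIdeal R, x ∉ maximalIdeal R ^ 2 ∧ ∀ p ∈ minimalPrimes R, x ∉ p := by
  classical
  by_contra! h
  have hfin := minimalPrimes.finite_of_isNoetherianRing R
  let s : Finset (Ideal R) := insert (maximalIdeal R ^ 2) hfin.toFinset
  have hsub : (maximalIdeal R : Set R) ⊆ ⋃ i ∈ (s : Set (Ideal R)), id i := fun x hx ↦ by
    by_cases hx2 : x ∈ maximalIdeal R ^ 2
    · exact Set.mem_biUnion (by simp [s]) hx2
    · obtain ⟨p, hp, hxp⟩ := h x hx hx2
      exact Set.mem_biUnion (by simp [s, hp]) hxp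
  have hht : ((maximalIdeal R).height : WithBot ℕ∞) = (n + 1 : ℕ) := by
    rw [maximalIdeal_height_eq_ringKrullDim, hn]
  have hht' : (maximalIdeal R).height = (n + 1 : ℕ) := by exact_mod_cast hht
  obtain ⟨i, hi, hle⟩ := (Ideal.subset_union_prime (maximalIdeal R ^ 2) (maximalIdeal R ^ 2)
    (fun i hi hne _ ↦ by
      have : i ∈ minimalPrimes R := by simpa [s, hne] using hi
      exact this.1.1)).mp hsub
  obtain rfl | hi : i = maximalIdeal R ^ 2 ∨ i ∈ minimalPrimes R := by simpa [s] using hi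
  · have hbot : maximalIdeal R = ⊥ :=
      Submodule.eq_bot_of_le_smul_of_le_jacobson_bot (maximalIdeal R) _
        (maximalIdeal R).fg_of_isNoetherianRing
        (by simpa [pow_two] using hle) (maximalIdeal_le_jacobson _)
    rw [hbot, Ideal.height_bot] at hht'
    exact absurd hht' (by exact_mod_cast (Nat.succ_ne_zero n).symm)
  · have := hi.1.1
    have h0 : i.height = 0 := Ideal.height_eq_zero_iff.mpr hi
    have := Ideal.height_mono hle
    rw [hht', h0] at this
    exact absurd this (by simp)

/-- A minimal prime P inside (x) omits `x`, so P = xP, and Nakayama gives P = 0. -/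
lemma IsLocalRing.isDomain_of_isPrime_span_singleton {R : Type*} [CommRing R] [IsLocalRing R]
    [IsNoetherianRing R] {x : R} (hx : x ∈ maximalIdeal R) (hmin : ∀ p ∈ minimalPrimes R, x ∉ p)
    (hprime : (Ideal.span {x}).IsPrime) : IsDomain R := by
  obtain ⟨P, hP, hPx⟩ := Ideal.exists_minimalPrimes_le (bot_le : ⊥ ≤ Ideal.span {x})
  have hPprime : P.IsPrime := hP.1.1
  have hbot : P = ⊥ := by
    refine Submodule.eq_bot_of_le_smul_of_le_jacobson_bot (Ideal.span {x}) P
      P.fg_of_isNoetherianRing (fun y hy ↦ ?_)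
      (((Ideal.span_singleton_le_iff_mem _).mpr hx).trans (maximalIdeal_le_jacobson _))
    obtain ⟨z, rfl⟩ := Ideal.mem_span_singleton'.mp (hPx hy)
    rw [smul_eq_mul, mul_comm z]
    exact Ideal.mul_mem_mul (Ideal.mem_span_singleton_self x)
      ((hPprime.mem_or_mem hy).resolve_right (hmin P hP))
  rw [hbot] at hPprime
  exact IsDomain.of_bot_isPrime R

/-- Induction through R/(x) with `x` outside 𝔪². The two claims go together: the quotient being a
domain makes R a domain, which makes `x` regular. -/
lemma IsRegularLocalRing.isDomain_and_exists_isWeaklyRegular (n : ℕ) :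
    ∀ (R : Type u) [CommRing R] [IsRegularLocalRing R], ringKrullDim R = n →
      IsDomain R ∧ ∃ rs : List R, RingTheory.Sequence.IsWeaklyRegular R rs ∧
        Ideal.ofList rs = maximalIdeal R := by
  induction n with
  | zero =>
    intro R _ _ hdim
    have hrank := IsRegularLocalRing.spanFinrank_maximalIdeal (R := R)
    rw [hdim, Nat.cast_inj,
      Submodule.spanFinrank_eq_zero_iff_eq_bot (maximalIdeal R).fg_of_isNoetherianRing] at hrank
    have : IsField R := IsLocalRing.isField_iff_maximalIdeal_eq.mpr hrank
    exact ⟨this.isDomain, [], .nil _ _, by rw [hrank, Ideal.ofList_nil]⟩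
  | succ n ih =>
    intro R _ _ hdim
    have hrank := IsRegularLocalRing.spanFinrank_maximalIdeal (R := R)
    rw [hdim, Nat.cast_inj] at hrank
    obtain ⟨x, hx, hx2, hmin⟩ := IsLocalRing.exists_mem_maximalIdeal_notMem_sq hdim
    have hle : Ideal.span {x} ≤ maximalIdeal R := (Ideal.span_singleton_le_iff_mem _).mpr hx
    have : Nontrivial (R ⧸ Ideal.span {x}) :=
      Ideal.Quotient.nontrivial_iff.mpr (ne_top_of_le_ne_top (maximalIdeal.isMaximal R).ne_top hle)
    have : IsLocalRing (R ⧸ Ideal.span {x}) :=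
      .of_surjective' (Ideal.Quotient.mk _) Ideal.Quotient.mk_surjective
    have hle' := IsLocalRing.spanFinrank_maximalIdeal_quotient_span_singleton_le hrank hx hx2
    have hge : (n : WithBot ℕ∞) ≤ ringKrullDim (R ⧸ Ideal.span {x}) := by
      have := Ideal.height_le_ringKrullDim_quotient_add_one hx
      rw [maximalIdeal_height_eq_ringKrullDim, hdim, Nat.cast_add, Nat.cast_one] at this
      exact ENat.WithBot.add_le_add_one_right_iff.mp this
    have hreg : IsRegularLocalRing (R ⧸ Ideal.span {x}) :=
      .of_spanFinrank_maximalIdeal_le _ (le_trans (by exact_mod_cast hle') hge)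
    have hdim' : ringKrullDim (R ⧸ Ideal.span {x}) = n := by
      refine le_antisymm ?_ hge
      rw [← hreg.spanFinrank_maximalIdeal]
      exact_mod_cast hle'
    obtain ⟨hdom, rs, hrs, hmax⟩ := ih _ hdim'
    have hprime : (Ideal.span {x}).IsPrime := (Ideal.Quotient.isDomain_iff_prime _).mp hdom
    have hR := IsLocalRing.isDomain_of_isPrime_span_singleton hx hmin hprime
    have hx0 : x ≠ 0 := by
      rintro rfl
      exact hx2 (zero_mem _)
    obtain ⟨rs, rfl⟩ := List.map_surjective_iff.mpr Ideal.Quotient.mk_surjective rs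
    refine ⟨hR, x :: rs, .cons ?_ ?_, ?_⟩
    · exact fun a b hab ↦ mul_left_cancel₀ hx0 hab
    · have e : (R ⧸ Ideal.span {x}) ≃ₗ[R] QuotSMulTop x R :=
        Submodule.quotEquivOfEq _ _ (by
          rw [← Submodule.ideal_span_singleton_smul, smul_eq_mul, Ideal.mul_top])
      rw [← e.isWeaklyRegular_congr]
      exact (RingTheory.Sequence.isWeaklyRegular_map_algebraMap_iff
        (S := R ⧸ Ideal.span {x}) (R ⧸ Ideal.span {x}) rs).mp hrs
    · rw [← Ideal.map_ofList] at hmax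
      have := congrArg (Ideal.comap (Ideal.Quotient.mk (Ideal.span {x}))) hmax
      rw [Ideal.comap_map_of_surjective _ Ideal.Quotient.mk_surjective,
        ← IsLocalRing.map_maximalIdeal_of_surjective _ Ideal.Quotient.mk_surjective,
        Ideal.comap_map_of_surjective _ Ideal.Quotient.mk_surjective,
        ← RingHom.ker_eq_comap_bot, Ideal.mk_ker] at this
      rw [Ideal.ofList_cons, sup_comm, this, sup_eq_left.mpr hle]

lemma IsRegularLocalRing.maximalIdealsGeneratedByRegularSequences (R : Type u) [CommRing R]
    [IsRegularLocalRing R] : MaximalIdealsGeneratedByRegularSequences R := by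
  intro m hm
  rw [IsLocalRing.eq_maximalIdeal hm]
  exact (isDomain_and_exists_isWeaklyRegular _ R
    IsRegularLocalRing.spanFinrank_maximalIdeal.symm).2

end RegularLocal

/-! ### Polynomial rings -/

namespace MaximalIdealsGeneratedByRegularSequences

variable {R : Type*} [CommRing R]

lemma of_ringEquiv {S : Type*} [CommRing S] (e : R ≃+* S)
    (H : MaximalIdealsGeneratedByRegularSequences R) :
    MaximalIdealsGeneratedByRegularSequences S := by
  intro m hm
  have := Ideal.comap_isMaximal_of_equiv e (p := m)
  obtain ⟨rs, hrs, hm'⟩ := H (m.comap e) this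
  refine ⟨rs.map e, ?_, ?_⟩
  · refine (AddEquiv.isWeaklyRegular_congr (e := e.toAddEquiv) ?_).mp hrs
    exact List.forall₂_map_right_iff.mpr (List.forall₂_same.mpr fun r _ x ↦ by simp)
  · have := congrArg (Ideal.map (e : R →+* S)) hm'
    rw [Ideal.map_ofList] at this
    exact this.trans (Ideal.map_comap_of_surjective _ e.surjective m)

lemma of_isField (hR : IsField R) : MaximalIdealsGeneratedByRegularSequences R := by
  intro m hm
  let := hR.toField
  refine ⟨[], .nil _ _, ?_⟩
  rw [Ideal.ofList_nil]
  exact ((Ideal.eq_bot_or_top m).resolve_right hm.ne_top).symm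

open Polynomial in
lemma polynomial [IsJacobsonRing R] (H : MaximalIdealsGeneratedByRegularSequences R) :
    MaximalIdealsGeneratedByRegularSequences R[X] := by
  intro P hP
  have hp : (P.comap C).IsMaximal := Polynomial.isMaximal_comap_C_of_isJacobsonRing P
  obtain ⟨rs, hrs, hrsp⟩ := H _ hp
  have hne : P ≠ (P.comap C).map C := by
    intro h
    have hmax : ((P.comap C).map C : Ideal R[X]).IsMaximal := h ▸ hP
    have e := Ideal.polynomialQuotientEquivQuotientPolynomial (P.comap C)
    have hfield := (Ideal.Quotient.maximal_ideal_iff_isField_quotient _).mp hmax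
    exact Polynomial.not_isField _ (e.toMulEquiv.isField hfield)
  -- The contraction of `P` is maximal since R is Jacobson, so `P` is its extension plus one monic
  -- `f`, which is regular modulo that prime extension.
  obtain ⟨f, hf, hPf⟩ := Polynomial.exists_monic_span_sup_map_eq _ P hp hne
  refine ⟨rs.map (algebraMap R R[X]) ++ [f], ?_, ?_⟩
  · rw [RingTheory.Sequence.isWeaklyRegular_append_iff]
    refine ⟨hrs.of_flat, ?_⟩
    rw [RingTheory.Sequence.isWeaklyRegular_singleton_iff]
    have hI : (Ideal.ofList (rs.map (algebraMap R R[X])) • ⊤ : Submodule R[X] R[X]) =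
        (P.comap C).map C := by
      rw [← Ideal.map_ofList, hrsp, smul_eq_mul, Ideal.mul_top, Polynomial.algebraMap_eq]
    rw [hI]
    have hprime : ((P.comap C).map C : Ideal R[X]).IsPrime :=
      Ideal.isPrime_map_C_iff_isPrime _ |>.mpr hp.isPrime
    have hfmem : f ∉ ((P.comap C).map C : Ideal R[X]) := by
      rw [Ideal.mem_map_C_iff]
      intro h
      have := h f.natDegree
      rw [hf.coeff_natDegree] at this
      exact hp.ne_top ((Ideal.eq_top_iff_one _).mpr this)
    change IsSMulRegular (R[X] ⧸ ((P.comap C).map C : Ideal R[X])) f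
    intro a b hab
    have hf0 : Ideal.Quotient.mk ((P.comap C).map C : Ideal R[X]) f ≠ 0 := by
      rwa [ne_eq, Ideal.Quotient.eq_zero_iff_mem]
    obtain ⟨a, rfl⟩ := Ideal.Quotient.mk_surjective a
    obtain ⟨b, rfl⟩ := Ideal.Quotient.mk_surjective b
    exact mul_left_cancel₀ hf0 hab
  · rw [Ideal.ofList_append, ← Ideal.map_ofList, hrsp, Ideal.ofList_singleton,
      Polynomial.algebraMap_eq, ← hPf]

lemma mvPolynomial_fin (K : Type*) [Field K] (n : ℕ) :
    MaximalIdealsGeneratedByRegularSequences (MvPolynomial (Fin n) K) := by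
  induction n with
  | zero =>
    exact of_ringEquiv (MvPolynomial.isEmptyRingEquiv K (Fin 0)).symm
      (of_isField (Field.toIsField K))
  | succ n ih => exact of_ringEquiv (MvPolynomial.finSuccEquiv K n).symm.toRingEquiv ih.polynomial

end MaximalIdealsGeneratedByRegularSequences

/-! ### Supports of tensor products and dimension -/

lemma Module.support_tensorProduct {R : Type*} [CommRing R] (M N : Type*) [AddCommGroup M]
    [Module R M] [Module.Finite R M] [AddCommGroup N] [Module R N] [Module.Finite R N] :
    support R (M ⊗[R] N) = support R M ∩ support R N := by
  ext p
  rw [Set.mem_inter_iff, mem_support_iff_nontrivial_residueField_tensorProduct,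
    mem_support_iff_nontrivial_residueField_tensorProduct,
    mem_support_iff_nontrivial_residueField_tensorProduct]
  have e := TensorProduct.AlgebraTensorModule.distribBaseChange R p.asIdeal.ResidueField M N
  rw [e.toEquiv.nontrivial_congr]
  refine ⟨fun h ↦ ⟨?_, ?_⟩, fun ⟨_, _⟩ ↦ inferInstance⟩
  · by_contra h'
    rw [not_nontrivial_iff_subsingleton] at h'
    exact not_subsingleton _ (inferInstance : Subsingleton
      ((p.asIdeal.ResidueField ⊗[R] M) ⊗[p.asIdeal.ResidueField] (p.asIdeal.ResidueField ⊗[R] N)))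
  · by_contra h'
    rw [not_nontrivial_iff_subsingleton] at h'
    exact not_subsingleton _ (inferInstance : Subsingleton
      ((p.asIdeal.ResidueField ⊗[R] M) ⊗[p.asIdeal.ResidueField] (p.asIdeal.ResidueField ⊗[R] N)))

section ModuleDim

variable {R : Type*} [CommRing R] [FiniteRingKrullDim R]

lemma moduleDim_le_iff {M : Type*} [AddCommGroup M] [Module R M] {n : ℕ} :
    moduleDim R M ≤ n ↔ ∀ s : LTSeries (support R M), s.length ≤ n := by
  have htop : supportDim R M ≠ ⊤ :=
    ne_top_of_le_ne_top ringKrullDim_ne_top (supportDim_le_ringKrullDim R M)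
  have h : moduleDim R M ≤ n ↔ supportDim R M ≤ n := by
    rw [moduleDim]
    generalize supportDim R M = d at htop
    induction d with
    | bot => simp
    | coe d =>
      lift d to ℕ using fun h ↦ htop (by rw [h]; rfl)
      exact Nat.cast_le.symm
  rw [h, supportDim, Order.krullDim, iSup_le_iff]
  exact forall_congr' fun s ↦ Nat.cast_le

variable {M N : Type*} [AddCommGroup M] [Module R M] [AddCommGroup N] [Module R N]

lemma moduleDim_mono (h : support R M ⊆ support R N) : moduleDim R M ≤ moduleDim R N :=
  moduleDim_le_iff.mpr fun s ↦ moduleDim_le_iff.mp le_rfl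
    (s.map (Set.inclusion h) fun _ _ hlt ↦ hlt)

lemma moduleDim_le_self : moduleDim R M ≤ moduleDim R R := by
  refine moduleDim_mono fun p _ ↦ ?_
  rw [mem_support_iff_of_finite, (annihilator_eq_bot (R := R) (M := R)).mpr inferInstance]
  exact bot_le

/-- The dimension of a module does not see a closed point of the support. -/
lemma moduleDim_le_of_support_subset {m : PrimeSpectrum R} (hm : m.asIdeal.IsMaximal)
    (h : ∀ p ∈ support R M, p ≠ m → p ∈ support R N) : moduleDim R M ≤ moduleDim R N := by
  refine moduleDim_le_iff.mpr fun s ↦ ?_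
  by_cases h0 : s.length = 0
  · omega
  have hhead : (s.head : PrimeSpectrum R) ∈ support R N := by
    refine h _ s.head.2 fun heq ↦ ?_
    have hlt : (s.head : PrimeSpectrum R) < s.last :=
      s.strictMono (show (0 : Fin (s.length + 1)) < Fin.last _ from Fin.pos_iff_ne_zero.mpr
        fun h ↦ h0 (by simpa using congrArg Fin.val h))
    rw [heq] at hlt
    exact s.last.1.2.ne_top (hm.out.2 _ hlt)
  have hmem : ∀ i, (s i : PrimeSpectrum R) ∈ support R N := fun i ↦
    mem_support_mono (s.monotone (Fin.zero_le i)) hhead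
  let s' : LTSeries (support R N) :=
    { length := s.length
      toFun i := ⟨s i, hmem i⟩
      step i := s.step i }
  exact moduleDim_le_iff.mp le_rfl s'

lemma moduleDim_eq_zero_of_support_subset {m : PrimeSpectrum R} (hm : m.asIdeal.IsMaximal)
    (h : support R M ⊆ {m}) : moduleDim R M = 0 := by
  have := moduleDim_le_of_support_subset (N := PUnit.{1}) hm fun p hp hne ↦ absurd (h hp) hne
  refine Nat.le_zero.mp (this.trans (moduleDim_le_iff.mpr fun s ↦ ?_))
  exact absurd s.head.2 (notMem_support_of_subsingleton _)

/-- Supports are closed under specialization, so a chain lies in any piece containing its smallest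
prime. -/
lemma moduleDim_le_iff_of_support_eq_iUnion {ι : Type*} {E : ι → Type*}
    [∀ i, AddCommGroup (E i)] [∀ i, Module R (E i)] (h : support R M = ⋃ i, support R (E i))
    {n : ℕ} : moduleDim R M ≤ n ↔ ∀ i, moduleDim R (E i) ≤ n := by
  refine ⟨fun hn i ↦ (moduleDim_mono (h ▸ Set.subset_iUnion (fun i ↦ support R (E i)) i)).trans hn, fun hn ↦ ?_⟩
  refine moduleDim_le_iff.mpr fun s ↦ ?_
  obtain ⟨i, hi⟩ := Set.mem_iUnion.mp (h.subset s.head.2)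
  have hmem : ∀ j, (s j : PrimeSpectrum R) ∈ support R (E i) := fun j ↦
    mem_support_mono (s.monotone (Fin.zero_le j)) hi
  let s' : LTSeries (support R (E i)) :=
    { length := s.length
      toFun j := ⟨s j, hmem j⟩
      step j := s.step j }
  exact moduleDim_le_iff.mp (hn i) s'

lemma exists_moduleDim_eq_of_support_eq_iUnion {ι : Type*} [Nonempty ι] {E : ι → Type*}
    [∀ i, AddCommGroup (E i)] [∀ i, Module R (E i)] (h : support R M = ⋃ i, support R (E i)) :
    ∃ i, moduleDim R (E i) = moduleDim R M := by
  by_contra! hne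
  have hle := (moduleDim_le_iff_of_support_eq_iUnion h).mp le_rfl
  have hlt : ∀ i, moduleDim R (E i) < moduleDim R M := fun i ↦ lt_of_le_of_ne (hle i) (hne i)
  have := (moduleDim_le_iff_of_support_eq_iUnion h).mpr fun i ↦ Nat.le_sub_one_of_lt (hlt i)
  have := hlt (Classical.arbitrary ι)
  omega

end ModuleDim

/-! ### Proper and very proper intersection -/

section Intersection

variable {R : Type u} [CommRing R] [IsNoetherianRing R] [HasExtIndices R]
variable {M N : Type u} [AddCommGroup M] [Module R M] [Module.Finite R M]
  [AddCommGroup N] [Module R N] [Module.Finite R N]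

lemma ExtRing.iUnion_support (M : Type u) [AddCommGroup M] [Module R M] [Module.Finite R M] :
    support R M = ⋃ i, support R (ExtRing R M i) :=
  Set.Subset.antisymm (fun _ hp ↦ Set.mem_iUnion.mpr (exists_mem_support hp))
    (Set.iUnion_subset fun i ↦ support_subset i)

lemma ExtRing.exists_support_subset_singleton {m : PrimeSpectrum R} (hM : IsUnmixedModule R M)
    (hCM : IsLocallyCohenMacaulay R m.asIdeal M) :
    ∃ c, ∀ i, i ≠ c → support R (ExtRing R M i) ⊆ {m} := by
  obtain ⟨c, hc⟩ : ∃ c, ∀ q : PrimeSpectrum R, IsAssociatedPrime q.asIdeal M →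
      q.natHeight = c := by
    by_cases h : ∃ q : PrimeSpectrum R, IsAssociatedPrime q.asIdeal M
    · obtain ⟨q, hq⟩ := h
      exact ⟨q.natHeight, fun q' hq' ↦ congrArg ENat.toNat (hM _ hq' _ hq)⟩
    · exact ⟨0, fun q hq ↦ absurd ⟨q, hq⟩ h⟩
  refine ⟨c, fun i hi p hp ↦ ?_⟩
  by_contra hne
  exact notMem_support_of_isCohenMacaulay hc
    (hCM p.asIdeal fun h ↦ hne (PrimeSpectrum.ext h)) hi hp

variable [FiniteRingKrullDim R]

theorem IntersectVeryProperly.intersectProperly (h : IntersectVeryProperly R M N) :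
    IntersectProperly R M N := by
  obtain ⟨hdim, h⟩ := h
  have hunion : support R (M ⊗[R] N) =
      ⋃ ij : ℕ × ℕ, support R (ExtRing R M ij.1 ⊗[R] ExtRing R N ij.2) := by
    simp only [support_tensorProduct]
    rw [ExtRing.iUnion_support M, ExtRing.iUnion_support N, Set.iUnion_inter_iUnion,
      Set.iUnion_prod']
  have hM := (moduleDim_le_iff_of_support_eq_iUnion (ExtRing.iUnion_support (R := R) M)).mp le_rfl
  have hN := (moduleDim_le_iff_of_support_eq_iUnion (ExtRing.iUnion_support (R := R) N)).mp le_rfl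
  obtain ⟨i, hi⟩ := exists_moduleDim_eq_of_support_eq_iUnion (ExtRing.iUnion_support (R := R) M)
  obtain ⟨j, hj⟩ := exists_moduleDim_eq_of_support_eq_iUnion (ExtRing.iUnion_support (R := R) N)
  obtain ⟨⟨k, l⟩, hkl⟩ := exists_moduleDim_eq_of_support_eq_iUnion hunion
  have hge := (moduleDim_le_iff_of_support_eq_iUnion hunion).mp le_rfl (i, j)
  have hij := h i j
  have hkl' := h k l
  have := hM k
  have := hN l
  simp only at hge hkl
  rw [IntersectProperly]
  -- The pair (i, j) gives ≥. The pair (k, l) gives ≤, the 0 in the maximum being harmless because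
  -- dim M + dim N ≥ dim R.
  omega

theorem IntersectProperly.intersectVeryProperly {m : PrimeSpectrum R} (hm : m.asIdeal.IsMaximal)
    (hM : IsUnmixedModule R M) (hCM : IsLocallyCohenMacaulay R m.asIdeal M)
    (hN : IsUnmixedModule R N) (hCN : IsLocallyCohenMacaulay R m.asIdeal N)
    (h : IntersectProperly R M N) : IntersectVeryProperly R M N := by
  rw [IntersectProperly] at h
  refine ⟨by omega, fun i j ↦ ?_⟩
  obtain ⟨c, hc⟩ := ExtRing.exists_support_subset_singleton hM hCM
  obtain ⟨c', hc'⟩ := ExtRing.exists_support_subset_singleton hN hCN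
  -- These bounds make the maximum 0 whenever one of the factors has dimension 0.
  have hMi : moduleDim R (ExtRing R M i) ≤ moduleDim R R := moduleDim_le_self
  have hNj : moduleDim R (ExtRing R N j) ≤ moduleDim R R := moduleDim_le_self
  by_cases hi : i = c
  · by_cases hj : j = c'
    · subst hi hj
      have hsuppM : ∀ p ∈ support R M, p ≠ m → p ∈ support R (ExtRing R M i) := fun p hp hne ↦ by
        obtain ⟨k, hk⟩ := ExtRing.exists_mem_support hp
        obtain rfl : k = i := by
          by_contra hki
          exact hne (hc k hki hk)
        exact hk
      have hsuppN : ∀ p ∈ support R N, p ≠ m → p ∈ support R (ExtRing R N j) := fun p hp hne ↦ by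
        obtain ⟨k, hk⟩ := ExtRing.exists_mem_support hp
        obtain rfl : k = j := by
          by_contra hkj
          exact hne (hc' k hkj hk)
        exact hk
      have h₁ : moduleDim R (ExtRing R M i) = moduleDim R M :=
        le_antisymm (moduleDim_mono (ExtRing.support_subset i))
          (moduleDim_le_of_support_subset hm hsuppM)
      have h₂ : moduleDim R (ExtRing R N j) = moduleDim R N :=
        le_antisymm (moduleDim_mono (ExtRing.support_subset j))
          (moduleDim_le_of_support_subset hm hsuppN)
      have h₃ : moduleDim R (ExtRing R M i ⊗[R] ExtRing R N j) = moduleDim R (M ⊗[R] N) := by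
        refine le_antisymm (moduleDim_mono ?_) (moduleDim_le_of_support_subset hm ?_)
        · simp only [support_tensorProduct]
          exact Set.inter_subset_inter (ExtRing.support_subset i) (ExtRing.support_subset j)
        · simp only [support_tensorProduct]
          exact fun p hp hne ↦ ⟨hsuppM p hp.1 hne, hsuppN p hp.2 hne⟩
      omega
    · have h₁ := moduleDim_eq_zero_of_support_subset hm (hc' j hj)
      have h₂ : moduleDim R (ExtRing R M i ⊗[R] ExtRing R N j) = 0 :=
        moduleDim_eq_zero_of_support_subset hm
          (by rw [support_tensorProduct]; exact Set.inter_subset_right.trans (hc' j hj))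
      omega
  · have h₁ := moduleDim_eq_zero_of_support_subset hm (hc i hi)
    have h₂ : moduleDim R (ExtRing R M i ⊗[R] ExtRing R N j) = 0 :=
      moduleDim_eq_zero_of_support_subset hm
        (by rw [support_tensorProduct]; exact Set.inter_subset_left.trans (hc i hi))
    omega

end Intersection

/-! ### Application to the two classes of rings -/

lemma irrelevantMaximalIdeal_isMaximal (K : Type*) [Field K] (n : ℕ) :
    (irrelevantMaximalIdeal K n).IsMaximal := by
  have : irrelevantMaximalIdeal K n =
      RingHom.ker (MvPolynomial.constantCoeff : MvPolynomial (Fin (n + 1)) K →+* K) := by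
    ext f
    rw [irrelevantMaximalIdeal, ← Set.image_univ, MvPolynomial.mem_ideal_span_X_image,
      RingHom.mem_ker, MvPolynomial.constantCoeff_eq]
    refine ⟨fun h ↦ ?_, fun h d hd ↦ ?_⟩
    · by_contra h0
      obtain ⟨i, -, hi⟩ := h 0 (MvPolynomial.mem_support_iff.mpr h0)
      exact hi rfl
    · have hd0 : d ≠ 0 := by
        rintro rfl
        exact MvPolynomial.mem_support_iff.mp hd h
      obtain ⟨i, hi⟩ := Finsupp.ne_iff.mp hd0
      exact ⟨i, trivial, hi⟩
  rw [this]
  exact RingHom.ker_isMaximal_of_surjective _ fun a ↦ ⟨MvPolynomial.C a, by simp⟩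

lemma MvPolynomial.finiteRingKrullDim_fin (K : Type*) [Field K] (n : ℕ) :
    FiniteRingKrullDim (MvPolynomial (Fin n) K) := by
  rw [finiteRingKrullDim_iff_ne_bot_and_top, MvPolynomial.ringKrullDim_of_isNoetherianRing,
    ringKrullDim_eq_zero_of_field, zero_add]
  exact ⟨WithBot.natCast_ne_bot _,
    fun h ↦ ENat.natCast_ne_top (Nat.card (Fin n)) (WithBot.coe_injective h)⟩

theorem lemma4p2 :
    -- graded case: finitely generated graded modules over `R = K[x_0, …, x_n]`
    (∀ (K : Type u) [Field K] (n : ℕ) (M N : Type u)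
        [AddCommGroup M] [Module (MvPolynomial (Fin (n + 1)) K) M]
        [Module.Finite (MvPolynomial (Fin (n + 1)) K) M]
        [AddCommGroup N] [Module (MvPolynomial (Fin (n + 1)) K) N]
        [Module.Finite (MvPolynomial (Fin (n + 1)) K) N],
        IsGradedModule K n M → IsGradedModule K n N →
        (IntersectVeryProperly (MvPolynomial (Fin (n + 1)) K) M N →
          IntersectProperly (MvPolynomial (Fin (n + 1)) K) M N) ∧
        (IsUnmixedModule (MvPolynomial (Fin (n + 1)) K) M →
          IsLocallyCohenMacaulay (MvPolynomial (Fin (n + 1)) K) (irrelevantMaximalIdeal K n) M →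
          IsUnmixedModule (MvPolynomial (Fin (n + 1)) K) N →
          IsLocallyCohenMacaulay (MvPolynomial (Fin (n + 1)) K) (irrelevantMaximalIdeal K n) N →
          IntersectProperly (MvPolynomial (Fin (n + 1)) K) M N →
          IntersectVeryProperly (MvPolynomial (Fin (n + 1)) K) M N)) ∧
    -- local case: finitely generated modules over a regular local ring containing a field
    (∀ (K R : Type u) [Field K] [CommRing R] [IsRegularLocalRing R] [Algebra K R] (M N : Type u)
        [AddCommGroup M] [Module R M] [Module.Finite R M]
        [AddCommGroup N] [Module R N] [Module.Finite R N],
        (IntersectVeryProperly R M N → IntersectProperly R M N) ∧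
        (IsUnmixedModule R M →
          IsLocallyCohenMacaulay R (IsLocalRing.maximalIdeal R) M →
          IsUnmixedModule R N →
          IsLocallyCohenMacaulay R (IsLocalRing.maximalIdeal R) N →
          IntersectProperly R M N → IntersectVeryProperly R M N)) := by
  refine ⟨fun K _ n M N _ _ _ _ _ _ _ _ ↦ ?_, fun K R _ _ _ _ M N _ _ _ _ _ _ ↦ ?_⟩
  · have := (MaximalIdealsGeneratedByRegularSequences.mvPolynomial_fin K (n + 1)).hasExtIndices
    have := MvPolynomial.finiteRingKrullDim_fin K (n + 1)
    have hm := irrelevantMaximalIdeal_isMaximal K n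
    exact ⟨fun h ↦ h.intersectProperly, fun hM hCM hN hCN h ↦
      h.intersectVeryProperly (m := ⟨_, hm.isPrime⟩) hm hM hCM hN hCN⟩
  · have := (IsRegularLocalRing.maximalIdealsGeneratedByRegularSequences R).hasExtIndices
    have hm := IsLocalRing.maximalIdeal.isMaximal R
    exact ⟨fun h ↦ h.intersectProperly, fun hM hCM hN hCN h ↦
      h.intersectVeryProperly (m := ⟨_, hm.isPrime⟩) hm hM hCM hN hCN⟩
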